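/- A permutation is a finite word over the positive integers without repeated letters, and $S_n$ is the set of permutations with letter set $\{1,\dots,n\}$. West's stack-sorting map $s$ on permutations is defined recursively: $s$ sends the empty word to itself, and if $\pi=LmR$, where $m$ is the largest entry of $\pi$, then $s(\pi)=s(L)\,s(R)\,m$. A permutation $\pi$ is uniquely sorted if it has exactly one preimage under $s$, that is, $|s^{-1}(\pi)|=1$. Let $\mathcal U_n(321)$ be the set of uniquely sorted permutations $\pi=\pi_1\cdots\pi_n\in S_n$ that avoid the pattern $321$, i.e. for which there are no indices $i_1<i_2<i_3$ with $\pi_{i_1}>\pi_{i_2}>\pi_{i_3}$. **Theorem.** For every integer $k\ge 0$, $$|\mathcal U_{2k+1}(321)|=C_k,$$ where $C_k=\frac{1}{k+1}\binom{2k}{k}$ is the $k$-th Catalan number. -/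

import Mathlib

namespace StackSorting

/-- A permutation is a finite word over the positive integers without repeated letters. -/
def IsPermutation (π : List ℕ) : Prop :=
  π.Nodup ∧ ∀ x ∈ π, 0 < x

/-- `Sym n` is the set of permutations of `{1, …, n}`, in one-line notation. -/
def Sym (n : ℕ) : Set (List ℕ) :=
  {π | IsPermutation π ∧ ∀ x, x ∈ π ↔ 1 ≤ x ∧ x ≤ n}

/-- The largest entry of a word (`0` for the empty word). -/
def maxEntry (π : List ℕ) : ℕ :=
  π.foldr max 0

/-- The part of a word to the left of the (first occurrence of the) letter `n`. -/
def leftOf (n : ℕ) (π : List ℕ) : List ℕ :=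
  π.takeWhile (fun x => x ≠ n)

/-- The part of a word to the right of the (first occurrence of the) letter `n`. -/
def rightOf (n : ℕ) (π : List ℕ) : List ℕ :=
  (π.dropWhile (fun x => x ≠ n)).tail

theorem maxEntry_mem : ∀ {π : List ℕ}, π ≠ [] → maxEntry π ∈ π
  | [], h => absurd rfl h
  | [a], _ => by simp [maxEntry]
  | a :: b :: t, _ => by
    have ih : maxEntry (b :: t) ∈ b :: t := maxEntry_mem (by simp)
    have h : maxEntry (a :: b :: t) = max a (maxEntry (b :: t)) := rfl
    rw [h]
    rcases max_choice a (maxEntry (b :: t)) with h | h <;> rw [h]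
    · simp
    · exact List.mem_cons_of_mem _ ih

theorem length_leftOf_add_length_rightOf {n : ℕ} :
    ∀ {π : List ℕ}, n ∈ π → (leftOf n π).length + (rightOf n π).length < π.length
  | a :: t, h => by
    by_cases ha : a = n
    · subst ha
      simp [leftOf, rightOf]
    · have ht : n ∈ t := by
        rcases List.mem_cons.1 h with h | h
        · exact absurd h.symm ha
        · exact h
      have ih := length_leftOf_add_length_rightOf ht
      simp only [leftOf, rightOf, ne_eq, decide_not] at ih ⊢
      simp only [List.takeWhile_cons, List.dropWhile_cons, ha, decide_false, Bool.not_false,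
        if_true, List.length_cons]
      omega

/-- West's stack-sorting map: the empty word is sent to itself, and `π = L n R`, where `n` is the
largest entry of `π`, is sent to `s(L) s(R) n`. -/
def stackSort (π : List ℕ) : List ℕ :=
  if π = [] then []
  else
    stackSort (leftOf (maxEntry π) π) ++ stackSort (rightOf (maxEntry π) π) ++ [maxEntry π]
termination_by π.length
decreasing_by
  all_goals
    have := length_leftOf_add_length_rightOf (maxEntry_mem ‹_›)
    omega

/-- The fertility of a permutation: the number of its preimages under the stack-sorting map. -/
noncomputable def fertility (π : List ℕ) : ℕ :=
  {σ : List ℕ | IsPermutation σ ∧ stackSort σ = π}.ncard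

/-- A permutation is uniquely sorted if its fertility is `1`. -/
def UniquelySorted (π : List ℕ) : Prop :=
  IsPermutation π ∧ fertility π = 1

/-- The normalization of a permutation: its `i`-th smallest entry is replaced by `i`. -/
def normalization (π : List ℕ) : List ℕ :=
  π.map fun x => (π.filter fun y => y ≤ x).length

/-- `σ` contains the pattern `τ` if some subsequence of `σ` has the same relative order as `τ`. -/
def Contains (σ τ : List ℕ) : Prop :=
  ∃ w : List ℕ, w.Sublist σ ∧ normalization w = normalization τ

/-- `U n T` is the set of uniquely sorted permutations of `{1, …, n}` that avoid every pattern
in `T`. -/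
def U (n : ℕ) (T : Set (List ℕ)) : Set (List ℕ) :=
  {π | π ∈ Sym n ∧ UniquelySorted π ∧ ∀ τ ∈ T, ¬ Contains π τ}

end StackSorting

/-! A preimage of a word `P m` with last letter `m` has the form `L m R` with `s(L) s(R) = P`. If
`P` is nonempty and is itself `s(τ)`, then `τ m` and `m τ` are two preimages. So when `P m` is
uniquely sorted and `P` is nonempty, `P` is not in the image, `L` and `R` are nonempty, and `s(L)`
and `s(R)` are uniquely sorted. If `P m` also avoids 321, induction forces `s(R)` to be a single
letter below the last letter of `s(L)` (`zigzag_of_existsUnique`).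

Unfolding this recursion gives words `m₁ e₁ ⋯ mₖ eₖ t` with `m₁ < ⋯ < mₖ < t` and `eᵢ < mᵢ`. All
repetition-free zigzag words are uniquely sorted (`Zigzag.existsUnique_stackSort_eq`), and such a
word avoids 321 exactly when the `eᵢ` increase. On the letters `1, …, 2k+1`, `t` is the maximum, and
the `eᵢ` and `mᵢ` are the two rows of a standard Young tableau of shape `(k, k)` (`mem_U_odd_iff`).
Reading the rows as positions of up and down steps gives the Dyck words of semilength `k`, counted
by `catalan k`. -/

namespace StackSorting

/-! ### The stack-sorting map and the shape of its preimages -/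

theorem le_maxEntry {π : List ℕ} : ∀ x ∈ π, x ≤ maxEntry π := by
  induction π with
  | nil => simp
  | cons a t ih =>
    intro x hx
    change x ≤ max a (maxEntry t)
    rcases List.mem_cons.1 hx with rfl | hx
    · exact le_max_left _ _
    · exact (ih x hx).trans (le_max_right _ _)

theorem leftOf_append_cons {n : ℕ} {L R : List ℕ} (h : n ∉ L) : leftOf n (L ++ n :: R) = L := by
  induction L with
  | nil => simp [leftOf]
  | cons a t ih =>
    simp only [List.mem_cons, not_or] at h
    have := ih h.2
    simp_all [leftOf, Ne.symm h.1]

theorem rightOf_append_cons {n : ℕ} {L R : List ℕ} (h : n ∉ L) : rightOf n (L ++ n :: R) = R := by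
  induction L with
  | nil => simp [rightOf]
  | cons a t ih =>
    simp only [List.mem_cons, not_or] at h
    have := ih h.2
    simp_all [rightOf, Ne.symm h.1]

@[simp] theorem stackSort_nil : stackSort [] = [] := by
  rw [stackSort]; simp

theorem stackSort_append_cons {m : ℕ} {L R : List ℕ} (hL : ∀ x ∈ L, x < m) (hR : ∀ x ∈ R, x < m) :
    stackSort (L ++ m :: R) = stackSort L ++ stackSort R ++ [m] := by
  have hm : maxEntry (L ++ m :: R) = m := by
    apply le_antisymm
    · have h : maxEntry (L ++ m :: R) ∈ L ++ m :: R := maxEntry_mem (by simp)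
      simp only [List.mem_append, List.mem_cons] at h
      rcases h with h | h | h
      · exact (hL _ h).le
      · exact h.le
      · exact (hR _ h).le
    · exact le_maxEntry _ (by simp)
  have hmL : m ∉ L := fun h => lt_irrefl _ (hL m h)
  rw [stackSort, if_neg (by simp), hm, leftOf_append_cons hmL, rightOf_append_cons hmL]

theorem exists_eq_append_max_cons {σ : List ℕ} (h : σ.Nodup) (h0 : σ ≠ []) :
    ∃ L m R, σ = L ++ m :: R ∧ (∀ x ∈ L, x < m) ∧ ∀ x ∈ R, x < m := by
  obtain ⟨L, R, hσ⟩ := List.append_of_mem (maxEntry_mem h0)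
  refine ⟨L, _, R, hσ, ?_, ?_⟩ <;> intro x hx <;>
    refine lt_of_le_of_ne (le_maxEntry x (by rw [hσ]; simp [hx])) ?_ <;> intro hxe <;>
    rw [hσ, ← hxe, List.nodup_middle, List.nodup_cons] at h <;>
    exact h.1 (by simp [hx])

theorem leftOf_append_rightOf {n : ℕ} {π : List ℕ} (h : n ∈ π) :
    leftOf n π ++ n :: rightOf n π = π := by
  induction π with
  | nil => simp at h
  | cons a t ih =>
    by_cases ha : a = n
    · simp [leftOf, rightOf, ha]
    · have ih := ih (by simpa [Ne.symm ha] using h)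
      simp_all [leftOf, rightOf]

theorem stackSort_perm (π : List ℕ) : (stackSort π).Perm π := by
  by_cases h : π = []
  · simp [h]
  · have hm := maxEntry_mem h
    have hlen := length_leftOf_add_length_rightOf hm
    rw [stackSort, if_neg h]
    conv_rhs => rw [← leftOf_append_rightOf hm]
    rw [List.append_assoc]
    refine (stackSort_perm (leftOf (maxEntry π) π)).append ?_
    refine ((stackSort_perm (rightOf (maxEntry π) π)).append_right _).trans ?_
    exact List.perm_append_comm
termination_by π.length
decreasing_by all_goals omega

theorem stackSort_eq_nil {π : List ℕ} (h : stackSort π = []) : π = [] := by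
  have := (stackSort_perm π).length_eq
  rw [h] at this
  exact List.length_eq_zero_iff.1 this.symm

theorem stackSort_singleton (m : ℕ) : stackSort [m] = [m] := by
  simpa using stackSort_append_cons (m := m) (L := []) (R := []) (by simp) (by simp)

/-- A preimage of `P ++ [m]` splits at `m` into preimages of the two parts of `P`. -/
theorem exists_split_of_stackSort_eq {σ P : List ℕ} {m : ℕ} (h : stackSort σ = P ++ [m])
    (hnd : (P ++ [m]).Nodup) :
    ∃ L R, σ = L ++ m :: R ∧ stackSort L ++ stackSort R = P ∧ (∀ x ∈ L, x < m) ∧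
      ∀ x ∈ R, x < m := by
  have hσ : σ.Nodup := by
    rw [← h] at hnd
    exact (stackSort_perm σ).nodup_iff.1 hnd
  have h0 : σ ≠ [] := by rintro rfl; simp at h
  obtain ⟨L, m', R, rfl, hL, hR⟩ := exists_eq_append_max_cons hσ h0
  rw [stackSort_append_cons hL hR] at h
  obtain ⟨h1, h2⟩ := List.append_inj' h rfl
  obtain rfl : m' = m := by simpa using h2
  exact ⟨L, R, rfl, h1, hL, hR⟩

theorem lt_of_stackSort_eq {σ P : List ℕ} {m : ℕ} (h : stackSort σ = P ++ [m])
    (hnd : (P ++ [m]).Nodup) : ∀ x ∈ P, x < m := by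
  obtain ⟨L, R, -, hP, hL, hR⟩ := exists_split_of_stackSort_eq h hnd
  intro x hx
  rw [← hP, List.mem_append] at hx
  rcases hx with hx | hx
  · exact hL x ((stackSort_perm L).mem_iff.1 hx)
  · exact hR x ((stackSort_perm R).mem_iff.1 hx)

theorem lt_of_mem_of_stackSort_eq {σ π : List ℕ} {m : ℕ} (h : stackSort σ = π)
    (hm : ∀ x ∈ π, x < m) : ∀ x ∈ σ, x < m := by
  intro x hx
  exact hm x (h ▸ (stackSort_perm σ).mem_iff.2 hx)

/-- The map only rearranges letters, so every preimage of a permutation is automatically a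
permutation. -/
theorem uniquelySorted_iff {π : List ℕ} :
    UniquelySorted π ↔ IsPermutation π ∧ ∃! σ, stackSort σ = π := by
  refine and_congr_right fun hπ => ?_
  have : {σ : List ℕ | IsPermutation σ ∧ stackSort σ = π} = {σ | stackSort σ = π} := by
    ext σ
    refine ⟨fun h => h.2, fun h => ⟨⟨?_, fun x hx => ?_⟩, h⟩⟩
    · exact (stackSort_perm σ).nodup_iff.1 (by rw [h]; exact hπ.1)
    · exact hπ.2 x (h ▸ (stackSort_perm σ).mem_iff.2 hx)
  rw [fertility, this, Set.ncard_eq_one]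
  simp only [Set.eq_singleton_iff_unique_mem]
  rfl

/-! ### Zigzag words are uniquely sorted -/

/-- Words of odd length in which every letter in odd position exceeds all letters before it and
the letter following it. -/
inductive Zigzag : List ℕ → Prop
  | single (m : ℕ) : Zigzag [m]
  | step {A : List ℕ} {a b m : ℕ} (hA : Zigzag (A ++ [a])) (hb : b < a)
      (hm : ∀ x ∈ A ++ [a], x < m) : Zigzag (A ++ [a] ++ [b] ++ [m])

theorem Zigzag.existsUnique_stackSort_eq {w : List ℕ} (hw : Zigzag w) (hnd : w.Nodup) :
    ∃! σ, stackSort σ = w := by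
  induction hw with
  | single m =>
    refine ⟨[m], stackSort_singleton m, fun σ hσ => ?_⟩
    have := stackSort_perm σ
    rw [hσ] at this
    exact List.perm_singleton.1 this.symm
  | @step A a b m _ hb hm ih =>
    have hnd' : (A ++ [a] ++ [b]).Nodup := hnd.sublist (List.sublist_append_left _ _)
    obtain ⟨τ, hτ, huniq⟩ := ih (hnd'.sublist (List.sublist_append_left _ _))
    refine ⟨τ ++ m :: [b], ?_, fun σ hσ => ?_⟩
    · have hbm : b < m := hb.trans (hm a (by simp))
      change stackSort _ = _
      rw [stackSort_append_cons (lt_of_mem_of_stackSort_eq hτ hm) (by simpa using hbm), hτ,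
        stackSort_singleton]
    · obtain ⟨L, R, rfl, hLR, -, -⟩ := exists_split_of_stackSort_eq hσ hnd
      -- Every nonempty sorted word ends with its maximum. Since `b < a`, neither `s(L)` nor `s(R)`
      -- can end with `a b`, so the cut falls between these two letters.
      rcases List.eq_nil_or_concat' (stackSort R) with hR | ⟨R', c, hR⟩
      · rw [hR, List.append_nil] at hLR
        have := lt_of_stackSort_eq hLR hnd' a (by simp)
        omega
      · rw [hR, ← List.append_assoc] at hLR
        obtain ⟨h1, h2⟩ := List.append_inj' hLR rfl
        obtain rfl : c = b := by simpa using h2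
        rcases List.eq_nil_or_concat' R' with rfl | ⟨R'', d, rfl⟩
        · rw [List.append_nil] at h1
          have hRp := stackSort_perm R
          rw [hR] at hRp
          rw [huniq L h1, List.perm_singleton.1 hRp.symm]
        · rw [← List.append_assoc] at h1
          obtain ⟨h3, h4⟩ := List.append_inj' h1 rfl
          obtain rfl : d = a := by simpa using h4
          have hndR : (R'' ++ [d] ++ [c]).Nodup := by
            rw [← h3] at hnd'
            refine hnd'.sublist ?_
            simp only [List.append_assoc]
            exact List.sublist_append_right _ _
          have := lt_of_stackSort_eq hR hndR d (by simp)
          omega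

theorem Zigzag.eq_singleton_or_descent {w : List ℕ} (hw : Zigzag w) :
    (∃ m, w = [m]) ∨ ∃ b c r, c < b ∧ w = b :: c :: r := by
  induction hw with
  | single m => exact Or.inl ⟨m, rfl⟩
  | @step A a b m _ hb hm ih =>
    right
    rcases ih with ⟨m', h⟩ | ⟨b', c', r, hlt, h⟩
    · rw [h]
      have : a = m' := by
        rcases A with _ | ⟨x, t⟩ <;> simp at h
        exact h
      exact ⟨m', b, [m], this ▸ hb, rfl⟩
    · exact ⟨b', c', r ++ [b] ++ [m], hlt, by rw [h]; simp⟩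

/-- Gluing tool for the converse: starting from a preimage of `A` followed by `b`, each further pair
`c m` of `B` is absorbed by appending `m c` to the preimage. -/
theorem Zigzag.exists_stackSort_eq_append {A B : List ℕ} {b : ℕ} (hB : Zigzag B)
    (hA : ∃ τ, stackSort τ = A) (hb : B.head? = some b) (hAb : ∀ x ∈ A, x < b) :
    ∃ τ, stackSort τ = A ++ B := by
  induction hB with
  | single m =>
    obtain rfl : m = b := by simpa using hb
    obtain ⟨τ, hτ⟩ := hA
    refine ⟨τ ++ m :: [], ?_⟩
    rw [stackSort_append_cons (lt_of_mem_of_stackSort_eq hτ hAb) (by simp), hτ]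
    simp
  | @step B a c m _ hc hm ih =>
    have hb' : (B ++ [a]).head? = some b := by
      rcases B with _ | ⟨x, t⟩ <;> simpa using hb
    obtain ⟨τ, hτ⟩ := ih hb'
    have hbm : b < m := hm b (List.mem_of_head? hb')
    have hcm : c < m := hc.trans (hm a (by simp))
    refine ⟨τ ++ m :: [c], ?_⟩
    rw [stackSort_append_cons (lt_of_mem_of_stackSort_eq hτ ?_) (by simpa using hcm), hτ,
      stackSort_singleton]
    · simp
    · intro x hx
      rcases List.mem_append.1 hx with hx | hx
      · exact (hAb x hx).trans hbm
      · exact hm x hx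

/-! ### Uniquely sorted words avoiding 321 are zigzag -/

/-- `w` has no decreasing subsequence of length three. -/
def Avoids321 (w : List ℕ) : Prop :=
  ∀ a b c, [a, b, c].Sublist w → b < a → c < b → False

theorem Avoids321.sublist {v w : List ℕ} (hw : Avoids321 w) (h : v.Sublist w) : Avoids321 v :=
  fun a b c hs => hw a b c (hs.trans h)

theorem contains_321_iff {w : List ℕ} : Contains w [3, 2, 1] ↔ ¬ Avoids321 w := by
  have h321 : normalization [3, 2, 1] = [3, 2, 1] := by decide
  unfold Contains Avoids321
  rw [h321]
  push Not
  constructor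
  · rintro ⟨v, hv, hn⟩
    have hlen := congrArg List.length hn
    simp only [normalization, List.length_map, List.length_cons, List.length_nil] at hlen
    obtain ⟨a, b, c, rfl⟩ := List.length_eq_three.1 hlen
    simp only [normalization, List.map_cons, List.map_nil, List.cons.injEq] at hn
    obtain ⟨-, h2, h3, -⟩ := hn
    have hcb : c < b := by
      by_contra! h
      by_cases ha : a ≤ c <;> simp [h, ha] at h3
    have hba : b < a := by
      by_contra! h
      simp [h, hcb.le] at h2
    exact ⟨a, b, c, hv, hba, hcb, trivial⟩
  · rintro ⟨a, b, c, hs, hba, hcb, -⟩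
    refine ⟨_, hs, ?_⟩
    simp [normalization, List.filter_cons, hba.le, hcb.le, (hcb.trans hba).le, hba.not_ge,
      hcb.not_ge, (hcb.trans hba).not_ge]

theorem zigzag_of_existsUnique {w : List ℕ} (hnd : w.Nodup) (h0 : w ≠ []) (hav : Avoids321 w)
    (hex : ∃! σ, stackSort σ = w) : Zigzag w := by
  obtain ⟨P, m, rfl⟩ : ∃ P m, w = P ++ [m] :=
    (List.eq_nil_or_concat' w).resolve_left h0
  obtain ⟨σ, hσ, huniq⟩ := hex
  have hPm := lt_of_stackSort_eq hσ hnd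
  -- a preimage of a nonempty `P` yields two preimages of `P ++ [m]`
  have hP : (∃ τ, stackSort τ = P) → P = [] := by
    rintro ⟨τ, hτ⟩
    have hlt := lt_of_mem_of_stackSort_eq hτ hPm
    have h1 := huniq (τ ++ m :: []) (by
      change stackSort _ = _
      rw [stackSort_append_cons hlt (by simp), hτ]
      simp)
    have h2 := huniq ([] ++ m :: τ) (by
      change stackSort _ = _
      rw [stackSort_append_cons (by simp) hlt, hτ]
      simp)
    rcases τ with _ | ⟨x, t⟩
    · simpa using hτ.symm
    · have h3 := h1.trans h2.symm
      simp only [List.cons_append, List.nil_append, List.cons.injEq] at h3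
      have := hlt x (by simp)
      omega
  obtain ⟨L, R, rfl, hLR, hL, hR⟩ := exists_split_of_stackSort_eq hσ hnd
  by_cases hL0 : L = []
  · rw [hP ⟨R, by simpa [hL0] using hLR⟩]
    exact .single m
  by_cases hR0 : R = []
  · rw [hP ⟨L, by simpa [hR0] using hLR⟩]
    exact .single m
  have hsubA : (stackSort L).Sublist (P ++ [m]) := by
    rw [← hLR, List.append_assoc]; exact List.sublist_append_left _ _
  have hsubB : (stackSort R).Sublist (P ++ [m]) := by
    rw [← hLR]
    exact (List.sublist_append_right _ _).trans (List.sublist_append_left _ _)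
  have hlen := congrArg List.length hLR
  have hlL := (stackSort_perm L).length_eq
  have hlR := (stackSort_perm R).length_eq
  have hpL := List.length_pos_iff.2 hL0
  have hpR := List.length_pos_iff.2 hR0
  rw [List.length_append] at hlen
  -- Another preimage of `s(L)` could replace `L` in `L m R`, against uniqueness; likewise for `R`
  -- below.
  have hA : Zigzag (stackSort L) := by
    refine zigzag_of_existsUnique (hnd.sublist hsubA) (mt stackSort_eq_nil hL0)
      (hav.sublist hsubA) ⟨L, rfl, fun L' hL' => ?_⟩
    have hlt : ∀ x ∈ L', x < m := lt_of_mem_of_stackSort_eq hL'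
      fun x hx => hL x ((stackSort_perm L).mem_iff.1 hx)
    have := huniq (L' ++ m :: R) (by
      change stackSort _ = _
      rw [stackSort_append_cons hlt hR, (hL' : stackSort L' = _), hLR])
    exact (List.append_inj_left' this rfl)
  have hB : Zigzag (stackSort R) := by
    refine zigzag_of_existsUnique (hnd.sublist hsubB) (mt stackSort_eq_nil hR0)
      (hav.sublist hsubB) ⟨R, rfl, fun R' hR' => ?_⟩
    have hlt : ∀ x ∈ R', x < m := lt_of_mem_of_stackSort_eq hR'
      fun x hx => hR x ((stackSort_perm R).mem_iff.1 hx)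
    have := huniq (L ++ m :: R') (by
      change stackSort _ = _
      rw [stackSort_append_cons hL hlt, (hR' : stackSort R' = _), hLR])
    simpa using this
  have hndP : P.Nodup := hnd.sublist (List.sublist_append_left _ _)
  obtain ⟨A, a, hAa⟩ : ∃ A a, stackSort L = A ++ [a] :=
    (List.eq_nil_or_concat' _).resolve_left (mt stackSort_eq_nil hL0)
  obtain ⟨b, B, hBb⟩ := List.exists_cons_of_ne_nil (mt stackSort_eq_nil hR0)
  have hPeq : P = A ++ a :: b :: B := by rw [← hLR, hAa, hBb]; simp
  have hamax := lt_of_stackSort_eq hAa (hAa ▸ hnd.sublist hsubA)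
  -- If `a < b`, gluing makes `P` sorted, which `hP` excludes. If `a > b`, either `s(R) = [b]`, or
  -- `s(R)` starts with a descent `b c` and `a b c` is a 321 pattern.
  rcases lt_trichotomy a b with hab | hab | hab
  · have := hP (hLR ▸ hB.exists_stackSort_eq_append ⟨L, rfl⟩ (by rw [hBb]; rfl) ?_)
    · simp [hPeq] at this
    · intro x hx
      rw [hAa, List.mem_append, List.mem_singleton] at hx
      rcases hx with hx | rfl
      · exact (hamax x hx).trans hab
      · exact hab
  · rw [hPeq, hab] at hndP
    simp [List.nodup_append] at hndP
  · rcases hB.eq_singleton_or_descent with ⟨c, hc⟩ | ⟨b', c, r, hcb, hc⟩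
    · rw [hBb] at hc
      obtain ⟨rfl, rfl⟩ : b = c ∧ B = [] := by simpa using hc
      have hPeq' : P = A ++ [a] ++ [b] := by simp [hPeq]
      rw [hPeq']
      exact .step (hAa ▸ hA) hab fun x hx => hPm x (by
        rw [hPeq']; exact List.mem_append_left _ hx)
    · rw [hBb] at hc
      obtain ⟨rfl, rfl⟩ : b = b' ∧ B = c :: r := by simpa using hc
      refine (hav a b c ?_ hab hcb).elim
      rw [hPeq]
      refine List.Sublist.trans ?_ (List.sublist_append_left _ _)
      refine List.Sublist.trans ?_ (List.sublist_append_right _ _)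
      simp
termination_by w.length
decreasing_by all_goals subst_vars; simp only [List.length_append, List.length_singleton]; omega

/-! ### Zigzag words as interleavings of two sequences -/

/-- The word `m₁ e₁ m₂ e₂ ⋯`, for `E = e₁ e₂ ⋯` and `M = m₁ m₂ ⋯`. -/
def weave : List ℕ → List ℕ → List ℕ
  | e :: E, m :: M => m :: e :: weave E M
  | _, _ => []

theorem weave_append {E M E' M' : List ℕ} (h : E.length = M.length) :
    weave (E ++ E') (M ++ M') = weave E M ++ weave E' M' := by
  induction E generalizing M with
  | nil =>
    obtain rfl := List.length_eq_zero_iff.1 h.symm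
    rfl
  | cons e E ih =>
    rcases M with _ | ⟨m, M⟩
    · simp at h
    · simp [weave, ih (by simpa using h)]

theorem weave_perm {E M : List ℕ} (h : E.length = M.length) : (weave E M).Perm (E ++ M) := by
  induction E generalizing M with
  | nil =>
    obtain rfl := List.length_eq_zero_iff.1 h.symm
    rfl
  | cons e E ih =>
    rcases M with _ | ⟨m, M⟩
    · simp at h
    · have h1 := (ih (M := M) (by simpa using h)).cons e
      refine (h1.cons m).trans ?_
      exact (List.perm_middle (l₁ := e :: E)).symm

theorem mem_weave {E M : List ℕ} (h : E.length = M.length) {x : ℕ} :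
    x ∈ weave E M ↔ x ∈ E ∨ x ∈ M := by
  rw [(weave_perm h).mem_iff, List.mem_append]

theorem weave_inj {E M E' M' : List ℕ} (h : E.length = M.length) (h' : E'.length = M'.length)
    (hw : weave E M = weave E' M') : E = E' ∧ M = M' := by
  induction E generalizing M E' M' with
  | nil =>
    obtain rfl := List.length_eq_zero_iff.1 h.symm
    rcases E' with _ | ⟨e', E'⟩ <;> rcases M' with _ | ⟨m', M'⟩ <;> simp_all [weave]
  | cons e E ih =>
    rcases M with _ | ⟨m, M⟩
    · simp at h
    rcases E' with _ | ⟨e', E'⟩ <;> rcases M' with _ | ⟨m', M'⟩ <;>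
      simp only [weave, List.cons.injEq, List.length_cons, List.length_nil] at h' hw
    · simp at hw
    · simp at h'
    · simp at h'
    · have := ih (by simpa using h) (by simpa using h') hw.2.2
      simp [this, hw.1, hw.2.1]

theorem filter_weave {p : ℕ → Bool} {E M : List ℕ} (h : E.length = M.length)
    (hE : ∀ x ∈ E, p x = true) (hM : ∀ x ∈ M, p x = false) : (weave E M).filter p = E := by
  induction E generalizing M with
  | nil =>
    obtain rfl := List.length_eq_zero_iff.1 h.symm
    rfl
  | cons e E ih =>
    rcases M with _ | ⟨m, M⟩
    · simp at h
    · simp only [List.mem_cons, forall_eq_or_imp] at hE hM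
      simp [weave, hE.1, hM.1, ih (M := M) (by simpa using h) hE.2 hM.2]

theorem filter_not_weave {p : ℕ → Bool} {E M : List ℕ} (h : E.length = M.length)
    (hE : ∀ x ∈ E, p x = false) (hM : ∀ x ∈ M, p x = true) : (weave E M).filter p = M := by
  induction E generalizing M with
  | nil =>
    obtain rfl := List.length_eq_zero_iff.1 h.symm
    rfl
  | cons e E ih =>
    rcases M with _ | ⟨m, M⟩
    · simp at h
    · simp only [List.mem_cons, forall_eq_or_imp] at hE hM
      simp [weave, hE.1, hM.1, ih (M := M) (by simpa using h) hE.2 hM.2]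

theorem exists_sublist_weave {E M : List ℕ} (h : List.Forall₂ (· < ·) E M) {e : ℕ} (he : e ∈ E) :
    ∃ m, e < m ∧ [m, e].Sublist (weave E M) := by
  induction h with
  | nil => simp at he
  | @cons e' m' E M hlt _ ih =>
    rcases List.mem_cons.1 he with rfl | he
    · exact ⟨m', hlt, by simp [weave]⟩
    · obtain ⟨m, hm, hs⟩ := ih he
      exact ⟨m, hm, (hs.cons _).cons _⟩

theorem forall₂_concat {R : ℕ → ℕ → Prop} {E M : List ℕ} {b a : ℕ} :
    List.Forall₂ R (E ++ [b]) (M ++ [a]) ↔ List.Forall₂ R E M ∧ R b a := by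
  rw [← List.forall₂_reverse_iff, ← List.forall₂_reverse_iff (l₁ := E)]
  simp [and_comm]

theorem pairwise_concat {M : List ℕ} {t : ℕ} :
    (M ++ [t]).Pairwise (· < ·) ↔ M.Pairwise (· < ·) ∧ ∀ x ∈ M, x < t := by
  simp [List.pairwise_append]

theorem lt_of_forall₂ {E M : List ℕ} (h : List.Forall₂ (· < ·) E M) {t : ℕ}
    (hM : ∀ x ∈ M, x < t) : ∀ x ∈ E, x < t := by
  induction h with
  | nil => simp
  | cons hlt _ ih =>
    simp only [List.mem_cons, forall_eq_or_imp] at hM ⊢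
    exact ⟨hlt.trans hM.1, ih hM.2⟩

theorem Zigzag.exists_eq_weave {w : List ℕ} (hw : Zigzag w) (hnd : w.Nodup) (hav : Avoids321 w) :
    ∃ E M t, w = weave E M ++ [t] ∧ E.Pairwise (· < ·) ∧ (M ++ [t]).Pairwise (· < ·) ∧
      List.Forall₂ (· < ·) E M := by
  induction hw with
  | single m => exact ⟨[], [], m, rfl, by simp, by simp, .nil⟩
  | @step A a b m _ hb hm ih =>
    have hsub : (A ++ [a] ++ [b]).Sublist (A ++ [a] ++ [b] ++ [m]) :=
      List.sublist_append_left _ _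
    have hsub' : (A ++ [a]).Sublist (A ++ [a] ++ [b]) := List.sublist_append_left _ _
    obtain ⟨E, M, t, hA, hE, hM, hEM⟩ := ih (hnd.sublist (hsub'.trans hsub))
      (hav.sublist (hsub'.trans hsub))
    obtain ⟨rfl, ht⟩ := List.append_inj' hA rfl
    obtain rfl : a = t := by simpa using ht
    have hlen := hEM.length_eq
    refine ⟨E ++ [b], M ++ [a], m, ?_, ?_, ?_, forall₂_concat.2 ⟨hEM, hb⟩⟩
    · simp [weave_append hlen, weave]
    · refine pairwise_concat.2 ⟨hE, fun e he => ?_⟩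
      obtain ⟨c, hec, hs⟩ := exists_sublist_weave hEM he
      have hs' : [c, e, b].Sublist (weave E M ++ [a] ++ [b] ++ [m]) := by
        have h1 : ([c, e] ++ [b]).Sublist (weave E M ++ [a] ++ [b]) :=
          (hs.trans (List.sublist_append_left _ _)).append (List.Sublist.refl [b])
        exact h1.trans hsub
      -- The letter `c` just before `e` exceeds it, so a later letter below `e` would complete a 321
      -- pattern.
      have h1 : ¬ b < e := fun h => hav c e b hs' hec h
      have h2 : e ≠ b := by
        have := hnd.sublist hs'
        simp only [List.nodup_cons, List.mem_cons] at this
        tauto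
      omega
    · refine pairwise_concat.2 ⟨hM, fun x hx => hm x ?_⟩
      simp only [List.mem_append, mem_weave hlen] at hx ⊢
      tauto

theorem zigzag_weave {E M : List ℕ} {t : ℕ} (hM : (M ++ [t]).Pairwise (· < ·))
    (hEM : List.Forall₂ (· < ·) E M) : Zigzag (weave E M ++ [t]) := by
  induction M using List.reverseRecOn generalizing E t with
  | nil =>
    obtain rfl : E = [] := by simpa using hEM
    exact .single t
  | append_singleton M a ih =>
    have hlen := hEM.length_eq
    rcases List.eq_nil_or_concat' E with rfl | ⟨E, b, rfl⟩
    · simp at hlen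
    obtain ⟨hEM', hba⟩ := forall₂_concat.1 hEM
    have hlen := hEM'.length_eq
    obtain ⟨hMa, hlt⟩ := pairwise_concat.1 hM
    have hlt' := lt_of_forall₂ hEM hlt
    have heq : weave (E ++ [b]) (M ++ [a]) ++ [t] = weave E M ++ [a] ++ [b] ++ [t] := by
      simp [weave_append hlen, weave]
    rw [heq]
    refine .step (ih hMa hEM') hba fun x hx => ?_
    simp only [List.mem_append, mem_weave hlen] at hx hlt hlt'
    rcases hx with (hx | hx) | hx
    · exact hlt' x (Or.inl hx)
    · exact hlt x (Or.inl hx)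
    · exact hlt x (Or.inr hx)

/-- Pigeonhole: of three letters, two lie in the same class, and these cannot decrease. -/
theorem avoids321_of_filter_pairwise {w : List ℕ} (p : ℕ → Bool)
    (h1 : (w.filter p).Pairwise (· < ·)) (h2 : (w.filter fun x => !p x).Pairwise (· < ·)) :
    Avoids321 w := by
  intro a b c hs hba hcb
  have k1 := h1.sublist (hs.filter p)
  have k2 := h2.sublist (hs.filter fun x => !p x)
  cases ha : p a <;> cases hb : p b <;> cases hc : p c <;>
    simp [ha, hb, hc] at k1 k2 <;> omega

theorem avoids321_weave {E M : List ℕ} {t : ℕ} (hE : E.Pairwise (· < ·))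
    (hM : (M ++ [t]).Pairwise (· < ·)) (hEM : List.Forall₂ (· < ·) E M)
    (hdisj : ∀ x ∈ E, x ∉ M) : Avoids321 (weave E M ++ [t]) := by
  have hlen := hEM.length_eq
  have htE : t ∉ E := fun h => lt_irrefl t (lt_of_forall₂ hEM (pairwise_concat.1 hM).2 t h)
  refine avoids321_of_filter_pairwise (fun x => decide (x ∈ E)) ?_ ?_
  · rw [List.filter_append, filter_weave hlen (by simp) (by
      intro x hx; simpa using fun h => hdisj x h hx)]
    simpa [htE] using hE
  · rw [List.filter_append, filter_not_weave hlen (by simp) (by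
      intro x hx; simpa using fun h => hdisj x h hx)]
    simpa [htE] using hM

/-! ### Reduction to two-row standard tableaux -/

/-- The first and second rows of a standard Young tableau of shape `(k, k)`. -/
structure IsTableau (k : ℕ) (E M : List ℕ) : Prop where
  pairwise_fst : E.Pairwise (· < ·)
  pairwise_snd : M.Pairwise (· < ·)
  forall₂ : List.Forall₂ (· < ·) E M
  disjoint : ∀ x ∈ E, x ∉ M
  mem_iff : ∀ x, (x ∈ E ∨ x ∈ M) ↔ 1 ≤ x ∧ x ≤ 2 * k

theorem mem_U_iff {n : ℕ} {w : List ℕ} :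
    w ∈ U n {[3, 2, 1]} ↔ w ∈ Sym n ∧ (∃! σ, stackSort σ = w) ∧ Avoids321 w := by
  simp only [U, Set.mem_ofPred_eq, uniquelySorted_iff, Set.mem_singleton_iff, forall_eq,
    contains_321_iff, not_not]
  exact ⟨fun h => ⟨h.1, h.2.1.2, h.2.2⟩, fun h => ⟨h.1, ⟨h.1.1, h.2.1⟩, h.2.2⟩⟩

theorem mem_U_odd_iff {k : ℕ} {w : List ℕ} :
    w ∈ U (2 * k + 1) {[3, 2, 1]} ↔ ∃ E M, IsTableau k E M ∧ w = weave E M ++ [2 * k + 1] := by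
  rw [mem_U_iff]
  constructor
  · rintro ⟨⟨⟨hnd, -⟩, hmem⟩, hex, hav⟩
    have h0 : w ≠ [] := List.ne_nil_of_mem ((hmem 1).2 (by omega))
    obtain ⟨E, M, t, rfl, hE, hM, hEM⟩ :=
      (zigzag_of_existsUnique hnd h0 hav hex).exists_eq_weave hnd hav
    have hlen := hEM.length_eq
    obtain ⟨hM', hlt⟩ := pairwise_concat.1 hM
    have hlt' := lt_of_forall₂ hEM hlt
    simp only [List.mem_append, mem_weave hlen, List.mem_singleton] at hmem
    -- The last letter dominates all others, and `2 * k + 1` occurs.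
    obtain rfl : t = 2 * k + 1 := by
      have h1 := (hmem t).1 (Or.inr rfl)
      rcases (hmem (2 * k + 1)).2 (by omega) with (h | h) | h
      · have := hlt' _ h
        omega
      · have := hlt _ h
        omega
      · omega
    refine ⟨E, M, ⟨hE, hM', hEM, ?_, fun x => ⟨fun h => ?_, fun h => ?_⟩⟩, rfl⟩
    · have h1 := ((weave_perm hlen).nodup_iff.1 (hnd.sublist (List.sublist_append_left _ _)))
      rw [List.nodup_append] at h1
      exact fun x hx hx' => h1.2.2 x hx x hx' rfl
    · have h1 := (hmem x).1 (Or.inl h)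
      rcases h with h | h
      · have := hlt' _ h
        omega
      · have := hlt _ h
        omega
    · rcases (hmem x).2 (by omega) with h | h
      · exact h
      · omega
  · rintro ⟨E, M, ⟨hE, hM, hEM, hdisj, hmem⟩, rfl⟩
    have hlen := hEM.length_eq
    have hM' : (M ++ [2 * k + 1]).Pairwise (· < ·) := by
      refine pairwise_concat.2 ⟨hM, fun x hx => ?_⟩
      have := (hmem x).1 (Or.inr hx)
      omega
    have hnd : (weave E M ++ [2 * k + 1]).Nodup := by
      have h1 : (E ++ M).Nodup := by
        refine List.nodup_append.2 ⟨hE.imp fun h => h.ne, hM.imp fun h => h.ne, ?_⟩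
        rintro x hx y hy rfl
        exact hdisj x hx hy
      refine List.nodup_append.2 ⟨(weave_perm hlen).nodup_iff.2 h1, by simp, ?_⟩
      rintro x hx y hy rfl
      have := (hmem x).1 ((mem_weave hlen).1 hx)
      have := List.mem_singleton.1 hy
      omega
    have hmem' : ∀ x, x ∈ weave E M ++ [2 * k + 1] ↔ 1 ≤ x ∧ x ≤ 2 * k + 1 := by
      intro x
      rw [List.mem_append, mem_weave hlen, hmem x, List.mem_singleton]
      omega
    exact ⟨⟨⟨hnd, fun x hx => ((hmem' x).1 hx).1⟩, hmem'⟩,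
      (zigzag_weave hM' hEM).existsUnique_stackSort_eq hnd, avoids321_weave hE hM' hEM hdisj⟩

/-! ### Tableaux and Dyck words -/

/-- The positions of the letter `s` in a word, counted from `i`. -/
def positions (s : DyckStep) : ℕ → List DyckStep → List ℕ
  | _, [] => []
  | i, t :: p => if t = s then i :: positions s (i + 1) p else positions s (i + 1) p

theorem mem_positions {s : DyckStep} {i x : ℕ} {p : List DyckStep} :
    x ∈ positions s i p ↔ ∃ j, x = i + j ∧ p[j]? = some s := by
  induction p generalizing i with
  | nil => simp [positions]
  | cons t p ih =>
    have key : (∃ j, x = i + j ∧ (t :: p)[j]? = some s) ↔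
        (x = i ∧ t = s) ∨ ∃ j, x = i + 1 + j ∧ p[j]? = some s := by
      constructor
      · rintro ⟨_ | j, hx, hj⟩
        · exact Or.inl ⟨hx, by simpa using hj⟩
        · exact Or.inr ⟨j, by omega, by simpa using hj⟩
      · rintro (⟨hx, hs⟩ | ⟨j, hx, hj⟩)
        · exact ⟨0, hx, by simpa using hs⟩
        · exact ⟨j + 1, by omega, by simpa using hj⟩
    rw [key, ← ih, positions]
    split_ifs with h <;> simp [h]

theorem pairwise_positions (s : DyckStep) (i : ℕ) (p : List DyckStep) :
    (positions s i p).Pairwise (· < ·) := by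
  induction p generalizing i with
  | nil => simp [positions]
  | cons t p ih =>
    rw [positions]
    split_ifs
    · refine List.pairwise_cons.2 ⟨fun x hx => ?_, ih _⟩
      obtain ⟨j, rfl, -⟩ := mem_positions.1 hx
      omega
    · exact ih _

theorem length_positions (s : DyckStep) (i : ℕ) (p : List DyckStep) :
    (positions s i p).length = p.count s := by
  induction p generalizing i with
  | nil => simp [positions]
  | cons t p ih =>
    rw [positions]
    split_ifs with h <;> simp [h, ih]

/-- Translates step counts in prefixes of a Dyck word into counts of small tableau entries. -/
theorem countP_positions (s : DyckStep) (i j : ℕ) (p : List DyckStep) :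
    (positions s i p).countP (· < i + j) = (p.take j).count s := by
  induction p generalizing i j with
  | nil => simp [positions]
  | cons t p ih =>
    rcases j with _ | j
    · simp only [List.take_zero, List.count_nil, List.countP_eq_zero]
      intro x hx
      obtain ⟨j, rfl, -⟩ := mem_positions.1 hx
      simp
    · have := ih (i + 1) j
      rw [show i + 1 + j = i + (j + 1) by omega] at this
      rw [positions]
      split_ifs with h <;> simp [h, this]

theorem countP_le_countP_of_forall₂ {E M : List ℕ} (h : List.Forall₂ (· < ·) E M) (v : ℕ) :
    M.countP (· < v) ≤ E.countP (· < v) := by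
  induction h with
  | nil => simp
  | @cons e m E M hlt _ ih =>
    simp only [List.countP_cons, decide_eq_true_eq]
    split_ifs <;> omega

/-- Converse of `countP_le_countP_of_forall₂` for increasing disjoint rows; together they identify
the column condition of a tableau with the ballot condition of a Dyck word. -/
theorem forall₂_of_countP_le {E M : List ℕ} (hlen : E.length = M.length)
    (hE : E.Pairwise (· < ·)) (hM : M.Pairwise (· < ·)) (hdisj : ∀ x ∈ E, x ∉ M)
    (h : ∀ v, M.countP (· < v) ≤ E.countP (· < v)) : List.Forall₂ (· < ·) E M := by
  induction E generalizing M with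
  | nil =>
    obtain rfl := List.length_eq_zero_iff.1 hlen.symm
    exact .nil
  | cons e E ih =>
    rcases M with _ | ⟨m, M⟩
    · simp at hlen
    rw [List.pairwise_cons] at hE hM
    have hem : e < m := by
      -- The bound `m + 1` counts `m` itself, so some entry of the first row is at most `m`; its
      -- least entry `e` then is too, and disjointness makes this strict.
      have h1 := h (m + 1)
      have h2 : 0 < (e :: E).countP (· < m + 1) := by
        refine lt_of_lt_of_le ?_ h1
        simp
      obtain ⟨x, hx, hxm⟩ := List.countP_pos_iff.1 h2
      have hxm : x < m + 1 := by simpa using hxm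
      have hne : e ≠ m := fun h => hdisj e (by simp) (by simp [h])
      rcases List.mem_cons.1 hx with rfl | hx
      · omega
      · have := hE.1 x hx
        omega
    refine .cons hem (ih (by simpa using hlen) hE.2 hM.2
      (fun x hx hx' => hdisj x (by simp [hx]) (by simp [hx'])) fun v => ?_)
    by_cases hv : m < v
    · simpa [List.countP_cons, hv, hem.trans hv] using h v
    · have : M.countP (· < v) = 0 := by
        rw [List.countP_eq_zero]
        intro x hx
        have := hM.1 x hx
        simp only [decide_eq_true_eq]
        omega
      omega

theorem eq_of_pairwise_lt {l l' : List ℕ} (h : l.Pairwise (· < ·)) (h' : l'.Pairwise (· < ·))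
    (hmem : ∀ x, x ∈ l ↔ x ∈ l') : l = l' :=
  ((List.perm_ext_iff_of_nodup (h.imp fun h => h.ne) (h'.imp fun h => h.ne)).2 hmem).eq_of_pairwise'
    h h'

theorem getElem?_eq_some_D_iff {p : List DyckStep} {j : ℕ} :
    p[j]? = some .D ↔ j < p.length ∧ p[j]? ≠ some .U := by
  by_cases h : j < p.length
  · rw [List.getElem?_eq_getElem h]
    cases p[j] <;> simp [h]
  · simp [h]

theorem eq_of_positions_eq {p q : List DyckStep} {i : ℕ}
    (hU : positions .U i p = positions .U i q) (hD : positions .D i p = positions .D i q) :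
    p = q := by
  have key : ∀ (s : DyckStep) (j : ℕ), p[j]? = some s ↔ q[j]? = some s := by
    intro s j
    have h : ∀ r : List DyckStep, r[j]? = some s ↔ i + j ∈ positions s i r := by
      intro r
      simp [mem_positions]
    rw [h, h]
    cases s
    · rw [hU]
    · rw [hD]
  refine List.ext_getElem? fun j => Option.ext fun s => key s j

theorem isTableau_positions (p : DyckWord) :
    IsTableau p.semilength (positions .U 1 p.toList) (positions .D 1 p.toList) := by
  have hdisj : ∀ x ∈ positions .U 1 p.toList, x ∉ positions .D 1 p.toList := by
    intro x hx hx'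
    obtain ⟨j, rfl, hj⟩ := mem_positions.1 hx
    obtain ⟨j', h, hj'⟩ := mem_positions.1 hx'
    obtain rfl : j' = j := by omega
    simp [hj] at hj'
  refine ⟨pairwise_positions _ _ _, pairwise_positions _ _ _, ?_, hdisj, fun x => ?_⟩
  · refine forall₂_of_countP_le ?_ (pairwise_positions _ _ _) (pairwise_positions _ _ _) hdisj ?_
    · rw [length_positions, length_positions, p.count_U_eq_count_D]
    · intro v
      rcases v with _ | v
      · simp
      · rw [add_comm v 1, countP_positions, countP_positions]
        exact p.count_D_le_count_U v
  · rw [mem_positions, mem_positions, p.two_mul_semilength_eq_length]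
    constructor
    · rintro (⟨j, rfl, hj⟩ | ⟨j, rfl, hj⟩) <;>
        have := (List.getElem?_eq_some_iff.1 hj).1 <;> omega
    · rintro ⟨h1, h2⟩
      have hlt : x - 1 < p.toList.length := by omega
      by_cases h : p.toList[x - 1]? = some .U
      · exact Or.inl ⟨x - 1, by omega, h⟩
      · exact Or.inr ⟨x - 1, by omega, getElem?_eq_some_D_iff.2 ⟨hlt, h⟩⟩

theorem IsTableau.exists_dyckWord {k : ℕ} {E M : List ℕ} (h : IsTableau k E M) :
    ∃ p : DyckWord, p.semilength = k ∧ positions .U 1 p.toList = E ∧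
      positions .D 1 p.toList = M := by
  -- Steps are indexed from 0 and tableau entries from 1, hence `j + 1`.
  let q : List DyckStep := (List.range (2 * k)).map fun j => if j + 1 ∈ E then .U else .D
  have hqlen : q.length = 2 * k := by simp [q]
  have hqU : ∀ j, q[j]? = some .U ↔ j + 1 ∈ E := by
    intro j
    by_cases hj : j < 2 * k
    · by_cases hE : j + 1 ∈ E <;> simp [q, hj, hE]
    · have : j + 1 ∉ E := fun hE => by
        have := (h.mem_iff _).1 (Or.inl hE)
        omega
      simp [q, hj, this]
  have hU : positions .U 1 q = E := by
    refine eq_of_pairwise_lt (pairwise_positions _ _ _) h.pairwise_fst fun x => ?_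
    rw [mem_positions]
    constructor
    · rintro ⟨j, rfl, hj⟩
      rw [add_comm]
      exact (hqU j).1 hj
    · intro hx
      have := (h.mem_iff x).1 (Or.inl hx)
      refine ⟨x - 1, by omega, (hqU _).2 ?_⟩
      rwa [Nat.sub_add_cancel this.1]
  have hD : positions .D 1 q = M := by
    refine eq_of_pairwise_lt (pairwise_positions _ _ _) h.pairwise_snd fun x => ?_
    rw [mem_positions]
    simp only [getElem?_eq_some_D_iff, ne_eq, hqU, hqlen]
    constructor
    · rintro ⟨j, rfl, hj, hjE⟩
      rw [add_comm] at hjE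
      exact ((h.mem_iff (1 + j)).2 (by omega)).resolve_left hjE
    · intro hx
      have := (h.mem_iff x).1 (Or.inr hx)
      refine ⟨x - 1, by omega, by omega, ?_⟩
      rw [Nat.sub_add_cancel this.1]
      exact fun hE => h.disjoint x hE hx
  have hUD : q.count .U = q.count .D := by
    rw [← length_positions .U 1, ← length_positions .D 1, hU, hD, h.forall₂.length_eq]
  let p : DyckWord := ⟨q, hUD, fun i => by
    rw [← countP_positions .D 1, ← countP_positions .U 1, hU, hD]
    exact countP_le_countP_of_forall₂ h.forall₂ _⟩
  refine ⟨p, ?_, hU, hD⟩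
  have := p.two_mul_semilength_eq_length
  change 2 * p.semilength = q.length at this
  omega

/-- The permutation whose even-position letters are the positions of the up steps of a Dyck word
and whose odd-position letters are the positions of the down steps, followed by a maximum. -/
def ofDyckWord (p : DyckWord) : List ℕ :=
  weave (positions .U 1 p.toList) (positions .D 1 p.toList) ++ [2 * p.semilength + 1]

theorem ofDyckWord_injective : Function.Injective ofDyckWord := by
  intro p q h
  have hp := (isTableau_positions p).forall₂.length_eq
  have hq := (isTableau_positions q).forall₂.length_eq
  obtain ⟨hU, hD⟩ := weave_inj hp hq (List.append_inj_left' h rfl)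
  exact DyckWord.ext (eq_of_positions_eq hU hD)

theorem image_ofDyckWord (k : ℕ) :
    ofDyckWord '' {p | p.semilength = k} = U (2 * k + 1) {[3, 2, 1]} := by
  ext w
  rw [mem_U_odd_iff]
  constructor
  · rintro ⟨p, rfl, rfl⟩
    exact ⟨_, _, isTableau_positions p, rfl⟩
  · rintro ⟨E, M, h, rfl⟩
    obtain ⟨p, rfl, rfl, rfl⟩ := h.exists_dyckWord
    exact ⟨p, rfl, rfl⟩

end StackSorting

theorem theorem8 (k : ℕ) :
    (StackSorting.U (2 * k + 1) {[3, 2, 1]}).ncard = catalan k := by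
  rw [← StackSorting.image_ofDyckWord,
    Set.ncard_image_of_injective _ StackSorting.ofDyckWord_injective,
    ← DyckWord.card_dyckWord_semilength_eq_catalan k, ← Nat.card_eq_fintype_card]
  rfl
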